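/- All groups are regarded as structures for the first-order language of groups $(\cdot,{}^{-1},1)$. A group is \emph{acylindrically hyperbolic} if it admits an acylindrical action by isometries on a geodesic Gromov-hyperbolic metric space $X$ with two independent loxodromic elements, i.e. two loxodromic elements whose pairs of limit points in the Gromov boundary $\partial_\infty X$ are disjoint. (An action of $G$ on $X$ is \emph{acylindrical} if for every $\varepsilon\ge 0$ there are $N,R>0$ such that for all $x,y\in X$ with $d(x,y)\ge R$ there are at most $N$ elements $g\in G$ with $d(x,gx)\le\varepsilon$ and $d(y,gy)\le\varepsilon$; an element $g$ is \emph{loxodromic} if $n\mapsto g^nx$ is a quasi-isometric embedding of $\mathbb Z$ into $X$ for some $x\in X$.) Acylindrical hyperbolicity is not preserved under elementary equivalence, not even among countable groups, if the groups are not required to be finitely generated. More precisely: \begin{enumerate} \item The free group $F_2$ of rank $2$ is acylindrically hyperbolic. \item Let $U$ be a non-principal ultrafilter on a countable set $I$ (or, more generally, a countably incomplete ultrafilter on an arbitrary set $I$, that is, one not closed under countable intersections), and let $G=F_2^I/U$ be the corresponding ultrapower of $F_2$. Then $G$ is elementarily equivalent to $F_2$, the centralizer of every element of $G$ is uncountable,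 and $G$ is not acylindrically hyperbolic. \item There exists a countable, torsion-free group $G'$ which is an elementary extension of $F_2$ and is not finitely generated, such that no element of $G'$ has cyclic centralizer, and such that $G'$ is not acylindrically hyperbolic. \end{enumerate} -/

import Mathlib

open Filter Topology
open scoped FirstOrder

/-! ### The first-order language of groups -/

/-- Function symbols of the language of groups. -/
inductive GroupFunc : ℕ → Type
  | mul : GroupFunc 2
  | inv : GroupFunc 1
  | one : GroupFunc 0

/-- The first-order language of groups `(·, ⁻¹, 1)`; there are no relation symbols besides equality. -/
def groupLanguage : FirstOrder.Language where
  Functions := GroupFunc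
  Relations := fun _ => Empty

/-- Every group is a structure for the language of groups, the symbols having their usual meaning. -/
instance groupLanguageStructure (G : Type*) [Group G] : groupLanguage.Structure G where
  funMap := fun {_} f =>
    match f with
    | .mul => fun x => x 0 * x 1
    | .inv => fun x => (x 0)⁻¹
    | .one => fun _ => 1
  RelMap := fun {_} r => nomatch r

/-! ### Hyperbolic spaces and the Gromov boundary -/

section Hyperbolic

variable (X : Type*) [MetricSpace X]

/-- Any two points are joined by a geodesic segment. -/
def IsGeodesicSpace : Prop :=
  ∀ x y : X, ∃ γ : ℝ → X, γ 0 = x ∧ γ (dist x y) = y ∧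
    ∀ s ∈ Set.Icc 0 (dist x y), ∀ t ∈ Set.Icc 0 (dist x y), dist (γ s) (γ t) = |s - t|

variable {X}

/-- The Gromov product `(x | y)_w`. -/
noncomputable def gromovProduct (w x y : X) : ℝ := (dist w x + dist w y - dist x y) / 2

variable (X)

/-- `X` is `δ`-hyperbolic for some `δ ≥ 0`. -/
def IsGromovHyperbolic : Prop :=
  ∃ δ : ℝ, 0 ≤ δ ∧ ∀ w x y z : X,
    min (gromovProduct w x y) (gromovProduct w y z) - δ ≤ gromovProduct w x z

variable {X}

/-- The sequence `s` converges to infinity: `(s m | s n)_w → ∞` as `m, n → ∞`. -/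
def ConvergesToInfinity (s : ℕ → X) : Prop :=
  ∀ w : X, Tendsto (fun p : ℕ × ℕ => gromovProduct w (s p.1) (s p.2)) atTop atTop

variable (X)

/-- The space of sequences converging to infinity. -/
def SequenceToInfinity : Type _ := {s : ℕ → X // ConvergesToInfinity s}

variable {X}

/-- Two sequences converging to infinity are equivalent when `(s n | t n)_w → ∞`. -/
def gromovBoundarySetoid (hX : IsGromovHyperbolic X) : Setoid (SequenceToInfinity X) where
  r s t := ∀ w : X, Tendsto (fun n : ℕ => gromovProduct w (s.1 n) (t.1 n)) atTop atTop
  iseqv :=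
    { refl := fun s w => (s.2 w).comp tendsto_atTop_diagonal
      symm := fun {s t} h w => by
        refine (h w).congr fun n => ?_
        simp only [gromovProduct, dist_comm (s.1 n) (t.1 n)]
        ring
      trans := fun {s t u} h₁ h₂ w => by
        obtain ⟨δ, -, hδ⟩ := hX
        rw [tendsto_atTop]
        intro b
        filter_upwards [(tendsto_atTop.1 (h₁ w)) (b + δ), (tendsto_atTop.1 (h₂ w)) (b + δ)]
          with n hn₁ hn₂
        have h := hδ w (s.1 n) (t.1 n) (u.1 n)
        have h' := le_min hn₁ hn₂
        linarith }

/-- The (sequential) Gromov boundary `∂_∞ X` of a hyperbolic space. -/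
def GromovBoundary (hX : IsGromovHyperbolic X) : Type _ := Quotient (gromovBoundarySetoid hX)

end Hyperbolic

/-! ### Acylindrical actions -/

section Actions

variable {G : Type*} [Group G] {X : Type*} [MetricSpace X] [MulAction G X]

/-- The points of the boundary that are limits of sequences in an orbit of `⟨g⟩`. For a loxodromic
`g`, this is the pair `{g^{+∞}, g^{-∞}}`. -/
def limitPoints (hX : IsGromovHyperbolic X) (g : G) : Set (GromovBoundary hX) :=
  {ξ | ∃ (x : X) (k : ℕ → ℤ) (hs : ConvergesToInfinity fun n => g ^ k n • x),
    ξ = Quotient.mk (gromovBoundarySetoid hX) ⟨fun n => g ^ k n • x, hs⟩}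

variable (X)

/-- `g` is loxodromic: an orbit map `n ↦ g ^ n • x` is a quasi-isometric embedding of `ℤ`. -/
def IsLoxodromic (g : G) : Prop :=
  ∃ (x : X) (K C : ℝ), 1 ≤ K ∧ 0 ≤ C ∧ ∀ m n : ℤ,
    |(m : ℝ) - n| / K - C ≤ dist (g ^ m • x) (g ^ n • x) ∧
    dist (g ^ m • x) (g ^ n • x) ≤ K * |(m : ℝ) - n| + C

variable (G)

/-- The action of `G` on `X` is acylindrical. -/
def IsAcylindricalAction : Prop :=
  ∀ ε : ℝ, 0 ≤ ε → ∃ (N : ℕ) (R : ℝ), 0 < N ∧ 0 < R ∧ ∀ x y : X, R ≤ dist x y →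
    {g : G | dist x (g • x) ≤ ε ∧ dist y (g • y) ≤ ε}.encard ≤ N

end Actions

/-- `G` is acylindrically hyperbolic: it has an acylindrical isometric action on a geodesic
hyperbolic space with two independent loxodromic elements. -/
def AcylindricallyHyperbolic.{u, v} (G : Type u) [Group G] : Prop :=
  ∃ (X : Type v) (_ : MetricSpace X) (_ : MulAction G X) (hX : IsGromovHyperbolic X),
    IsGeodesicSpace X ∧ IsIsometricSMul G X ∧ IsAcylindricalAction G X ∧
    ∃ g h : G, IsLoxodromic X g ∧ IsLoxodromic X h ∧
      Disjoint (limitPoints hX g) (limitPoints hX h)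

universe u v

/-! ### Centralizers of loxodromic elements -/

section Loxodromic

/-! The obstruction is that in an acylindrical action on a hyperbolic space, an element `c`
commuting with a loxodromic `g` satisfies `c ^ n = g ^ k` for some `n > 0`
(`IsLoxodromic.exists_pow_eq_zpow_of_commute`). Indeed each power of `c`, corrected by a power of `h
= g ^ m`, moves two far apart points of an `h`-orbit by a bounded amount, so two of the corrected
powers coincide. Hence a group in which every `g ≠ 1` commutes with some `c` satisfying no such
relation is not acylindrically hyperbolic.

In a countably incomplete ultrapower of a torsion-free group, `c = g ^ φ` with an infinite exponent
`φ` has this property. Łoś's theorem gives elementary equivalence, and a diagonal argument gives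
uncountable centralizers. The countable example is a subgroup of an ultrapower over `ℕ`, closed
under `g ↦ c` and under Tarski–Vaught witnesses. It is the union of a strictly increasing chain,
hence not finitely generated.

The free group acts on the real tree spanned by its word metric (`TreeHull`). The metric is
0-hyperbolic because Gromov products at `1` are lengths of common prefixes. -/

theorem IsGromovHyperbolic.four_point {X : Type*} [MetricSpace X] (hX : IsGromovHyperbolic X) :
    ∃ δ : ℝ, 0 ≤ δ ∧ ∀ x y z w : X,
      dist x z + dist y w ≤ max (dist x y + dist z w) (dist x w + dist y z) + δ := by
  obtain ⟨δ, hδ, h⟩ := hX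
  refine ⟨2 * δ, by positivity, fun x y z w => ?_⟩
  have h' := h w x y z
  simp only [gromovProduct] at h'
  rw [dist_comm w x, dist_comm w y, dist_comm w z] at h'
  rcases min_choice ((dist x w + dist y w - dist x y) / 2) ((dist y w + dist z w - dist y z) / 2)
    with e | e <;> rw [e] at h'
  · have := le_max_left (dist x y + dist z w) (dist x w + dist y z)
    linarith
  · have := le_max_right (dist x y + dist z w) (dist x w + dist y z)
    linarith

/-- Some power of a loxodromic element doubles displacement up to an additive gain. -/
theorem IsLoxodromic.exists_gain {G : Type*} [Group G] {X : Type*} [MetricSpace X]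
    [MulAction G X] {g : G} (hg : IsLoxodromic X g) :
    ∃ x : X, ∀ L : ℝ, ∃ m : ℕ, dist x (g ^ m • x) + L ≤ dist x (g ^ (2 * m) • x) := by
  obtain ⟨x, K, C, hK, hC, h⟩ := hg
  refine ⟨x, fun L => ?_⟩
  by_contra! hcon
  -- Without a gain, doubling the exponent adds less than `L`, so displacement at `2 ^ k` is at most
  -- linear in `k`; the quasi-isometry bound makes it exponential.
  have key : ∀ k : ℕ, dist x (g ^ (2 ^ k) • x) ≤ dist x (g ^ 1 • x) + k * L := by
    intro k
    induction k with
    | zero => simp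
    | succ k ih =>
      have := hcon (2 ^ k)
      rw [← pow_succ'] at this
      push_cast
      linarith
  have low : ∀ k : ℕ, (2 : ℝ) ^ k ≤ K * (C + dist x (g ^ 1 • x)) + k * (K * L) := by
    intro k
    have h1 := (h 0 ((2 ^ k : ℕ) : ℤ)).1
    rw [zpow_zero, one_smul, zpow_natCast] at h1
    have h2 := key k
    have h3 : |((0 : ℤ) : ℝ) - (((2 ^ k : ℕ) : ℤ) : ℝ)| = 2 ^ k := by
      push_cast
      rw [zero_sub, abs_neg, abs_of_nonneg (by positivity)]
    rw [h3] at h1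
    have h4 : (2 : ℝ) ^ k / K ≤ C + dist x (g ^ 1 • x) + k * L := by linarith
    rw [div_le_iff₀ (by linarith)] at h4
    linarith
  have t1 : Tendsto (fun k : ℕ => (k : ℝ) ^ 1 / 2 ^ k) atTop (𝓝 0) :=
    tendsto_pow_const_div_const_pow_of_one_lt 1 (by norm_num)
  have t0 : Tendsto (fun k : ℕ => (k : ℝ) ^ 0 / 2 ^ k) atTop (𝓝 0) :=
    tendsto_pow_const_div_const_pow_of_one_lt 0 (by norm_num)
  have t := (t0.const_mul (K * (C + dist x (g ^ 1 • x)))).add (t1.const_mul (K * L))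
  simp only [mul_zero, add_zero] at t
  obtain ⟨k, hk⟩ := (t.eventually (gt_mem_nhds (zero_lt_one' ℝ))).exists
  have h2 : (0 : ℝ) < 2 ^ k := by positivity
  have := low k
  have e : K * (C + dist x (g ^ 1 • x)) * ((k : ℝ) ^ 0 / 2 ^ k) + K * L * ((k : ℝ) ^ 1 / 2 ^ k)
      = (K * (C + dist x (g ^ 1 • x)) + k * (K * L)) / 2 ^ k := by
    field_simp
  rw [e, div_lt_one h2] at hk
  linarith

variable {G : Type*} [Group G] {X : Type*} [MetricSpace X] [MulAction G X] [IsIsometricSMul G X]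

theorem dist_pow_smul_pow_smul (g : G) (x : X) (m n : ℕ) :
    dist (g ^ m • x) (g ^ (m + n) • x) = dist x (g ^ n • x) := by
  rw [pow_add, mul_smul, dist_smul]

theorem dist_pow_add_le (g : G) (x : X) (m n : ℕ) :
    dist x (g ^ (m + n) • x) ≤ dist x (g ^ m • x) + dist x (g ^ n • x) := by
  rw [← dist_pow_smul_pow_smul g x m n]
  exact dist_triangle _ _ _

/-- If `h` doubles displacement with sufficient gain, then the displacements of its powers grow
linearly and are almost superadditive. -/
theorem displacement_growth {δ : ℝ} (hδ : 0 ≤ δ)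
    (h4 : ∀ x y z w : X,
      dist x z + dist y w ≤ max (dist x y + dist z w) (dist x w + dist y z) + δ)
    {h : G} {x : X} (hh : dist x (h ^ 1 • x) + (2 * δ + 1) ≤ dist x (h ^ 2 • x)) :
    (∀ n : ℕ, (n : ℝ) ≤ dist x (h ^ (n + 1) • x)) ∧
    ∀ p r : ℕ, dist x (h ^ p • x) + dist x (h ^ r • x) ≤
      dist x (h ^ (p + r) • x) + (2 * dist x (h ^ 2 • x) + δ) := by
  set b : ℕ → ℝ := fun n => dist x (h ^ n • x) with hb
  have hb0 : b 0 = 0 := by simp [hb]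
  have hbn : ∀ n, 0 ≤ b n := fun n => dist_nonneg
  have four : ∀ p q r : ℕ, b (p + q) + b (q + r) ≤ max (b p + b r) (b (p + q + r) + b q) + δ := by
    intro p q r
    have := h4 x (h ^ p • x) (h ^ (p + q) • x) (h ^ (p + q + r) • x)
    rw [dist_pow_smul_pow_smul, add_assoc p q r, dist_pow_smul_pow_smul, ← add_assoc p q r,
      dist_pow_smul_pow_smul] at this
    exact this
  -- Of the gain `2 * δ + 1`, one `δ` is spent on the four-point inequality.
  have step : ∀ r : ℕ, b (r + 1) + (δ + 1) ≤ max (b r) (b (r + 2)) := by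
    intro r
    have := four 1 1 r
    rw [show 1 + 1 + r = r + 2 by ring, show 1 + r = r + 1 by ring, show 1 + 1 = 2 from rfl,
      add_comm (b 1) (b r), max_add_add_right] at this
    have hh' : b 1 + (2 * δ + 1) ≤ b 2 := hh
    linarith
  -- Once `b` has increased, the alternative `b r` in `step` is impossible, so growth propagates.
  have mono : ∀ r : ℕ, b r ≤ b (r + 1) ∧ b (r + 1) + (δ + 1) ≤ b (r + 2) := by
    intro r
    induction r with
    | zero =>
      have hh' : b 1 + (2 * δ + 1) ≤ b 2 := hh
      refine ⟨by rw [hb0]; exact hbn _, ?_⟩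
      simp only [zero_add]
      linarith
    | succ r ih =>
      have h1 : b (r + 1) ≤ b (r + 2) := by linarith
      refine ⟨h1, ?_⟩
      have h2 := step (r + 1)
      rcases le_max_iff.1 h2 with h3 | h3
      · have h3' : b (r + 2) + (δ + 1) ≤ b (r + 1) := h3
        linarith
      · exact h3
  refine ⟨fun n => ?_, fun p r => ?_⟩
  · change (n : ℝ) ≤ b (n + 1)
    induction n with
    | zero => simpa using hbn 1
    | succ n ih =>
      have := (mono n).2
      push_cast
      rw [show n + 1 + 1 = n + 2 from rfl]
      linarith
  · change b p + b r ≤ b (p + r) + (2 * b 2 + δ)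
    -- The gap 2 ensures `b p + (δ + 1) ≤ b (p + 2)` even for `p = 0`, which rules out the first
    -- term of the maximum.
    have h1 := four p 2 r
    have hp := mono p
    have hr := mono r
    rw [show 2 + r = r + 2 by ring] at h1
    have h3 : b (p + 2 + r) ≤ b (p + r) + b 2 := by
      rw [show p + 2 + r = (p + r) + 2 by ring]
      exact dist_pow_add_le h x (p + r) 2
    rcases le_total (b p + b r) (b (p + 2 + r) + b 2) with h2 | h2
    · rw [max_eq_right h2] at h1
      linarith
    · rw [max_eq_left h2] at h1
      linarith

/-- If `x` is an almost nearest point to `y` on the orbit of `x`, then the path from `y` to a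
point of the orbit passes close to `x`. -/
theorem dist_orbit_of_almost_nearest {δ M : ℝ}
    (h4 : ∀ x y z w : X,
      dist x z + dist y w ≤ max (dist x y + dist z w) (dist x w + dist y z) + δ)
    {h : G} {x : X}
    (hM : ∀ p r : ℕ, dist x (h ^ p • x) + dist x (h ^ r • x) ≤ dist x (h ^ (p + r) • x) + M)
    {y : X} (hy : ∀ k : ℕ, dist y x ≤ dist y (h ^ k • x) + 1) (n : ℕ) :
    dist y x + dist x (h ^ n • x) ≤
      dist y (h ^ n • x) + 2 * (1 + dist x (h ^ 1 • x) + M + δ) := by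
  set b : ℕ → ℝ := fun n => dist x (h ^ n • x) with hb
  set f : ℕ → ℝ := fun n => dist y (h ^ n • x) with hf
  have hM' : ∀ p r : ℕ, b p + b r ≤ b (p + r) + M := hM
  have hb0 : b 0 = 0 := by simp [hb]
  have hM0 : 0 ≤ M := by have := hM' 0 0; simp only [hb0] at this; linarith
  have hbn : ∀ n, 0 ≤ b n := fun n => dist_nonneg
  change dist y x + b n ≤ f n + 2 * (1 + b 1 + M + δ)
  -- `P` is the Gromov product at `x` of `y` and `h ^ n • x`. A discrete intermediate value argument
  -- finds an orbit point at distance about `P` from `x`; if `P` were large, that point would be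
  -- much closer to `y` than `x` is.
  obtain ⟨P, hP⟩ : ∃ P, 2 * P = dist y x + b n - f n := ⟨(dist y x + b n - f n) / 2, by ring⟩
  have hP0 : 0 ≤ P := by
    have : f n ≤ dist y x + b n := dist_triangle _ _ _
    linarith
  have hPn : P ≤ b n := by
    have : dist y x ≤ f n + b n := by
      have := dist_triangle y (h ^ n • x) x
      rwa [dist_comm (h ^ n • x) x] at this
    linarith
  obtain ⟨k, hkn, hk1, hk2⟩ : ∃ k ≤ n, b k ≤ P ∧ P ≤ b k + b 1 := by
    classical
    by_cases hn : b n ≤ P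
    · exact ⟨n, le_rfl, hn, by linarith [hbn 1]⟩
    have hex : ∃ k, P < b k := ⟨n, not_le.1 hn⟩
    have hlt := Nat.find_spec hex
    have hle := Nat.find_min' hex (not_le.1 hn)
    obtain ⟨k, hk⟩ : ∃ k, Nat.find hex = k + 1 := by
      refine Nat.exists_eq_succ_of_ne_zero fun h0 => ?_
      rw [h0, hb0] at hlt
      linarith
    have hmin := Nat.find_min hex (m := k) (by omega)
    rw [hk] at hlt hle
    refine ⟨k, by omega, not_lt.1 hmin, ?_⟩
    have : b (k + 1) ≤ b k + b 1 := dist_pow_add_le h x k 1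
    linarith
  obtain ⟨r, rfl⟩ := Nat.exists_eq_add_of_le hkn
  have h1 := h4 y x (h ^ k • x) (h ^ (k + r) • x)
  rw [dist_pow_smul_pow_smul] at h1
  have h1' : f k + b (k + r) ≤ max (dist y x + b r) (f (k + r) + b k) + δ := h1
  have h2 := hM' k r
  have h3 : dist y x ≤ f k + 1 := hy k
  rcases le_max_iff.1 (sub_le_iff_le_add.2 h1') with h5 | h5 <;> linarith [hbn 1]

/-- In an acylindrical action on a hyperbolic space, every element of the centralizer of a
loxodromic element `g` has a nontrivial power in `⟨g⟩`. -/
theorem IsLoxodromic.exists_pow_eq_zpow_of_commute (hX : IsGromovHyperbolic X)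
    (hac : IsAcylindricalAction G X) {g c : G} (hg : IsLoxodromic X g) (hc : Commute c g) :
    ∃ n : ℕ, 0 < n ∧ ∃ k : ℤ, c ^ n = g ^ k := by
  obtain ⟨δ, hδ, h4⟩ := hX.four_point
  obtain ⟨x, hx⟩ := hg.exists_gain
  obtain ⟨m, hm⟩ := hx (2 * δ + 1)
  obtain ⟨h, rfl⟩ : ∃ h, h = g ^ m := ⟨_, rfl⟩
  set h := g ^ m with hdef
  have hh : dist x (h ^ 1 • x) + (2 * δ + 1) ≤ dist x (h ^ 2 • x) := by
    rwa [pow_one, hdef, ← pow_mul, mul_comm m 2]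
  have hch : Commute c h := hc.pow_right m
  obtain ⟨hlin, hsup⟩ := displacement_growth hδ h4 hh
  set M := 2 * dist x (h ^ 2 • x) + δ
  set Q := 1 + dist x (h ^ 1 • x) + M + δ with hQ
  have hQ0 : 0 ≤ Q := by positivity
  -- an element commuting with `h` that almost minimizes the distance to the orbit is short
  have short : ∀ u : G, Commute u h → (∀ k : ℤ, dist (u • x) x ≤ dist (u • x) (h ^ k • x) + 1) →
      dist x (u • x) ≤ 2 * Q + δ := by
    intro u hu hmin
    obtain ⟨N, hN⟩ := exists_nat_gt (2 * Q + δ)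
    have hbN := hlin N
    set n := N + 1
    have h1 := dist_orbit_of_almost_nearest h4 hsup (y := u • x)
      (fun k => by simpa using hmin k) n
    have h2 := dist_orbit_of_almost_nearest h4 hsup (y := u⁻¹ • x)
      (fun k => by
        have e1 : dist (u⁻¹ • x) x = dist (u • x) x := by
          rw [← dist_smul u, smul_inv_smul, dist_comm]
        have e2 : dist (u⁻¹ • x) (h ^ k • x) = dist (u • x) (h ^ (-(k : ℤ)) • x) := by
          rw [← dist_smul (h ^ (-(k : ℤ)) * u), mul_smul, smul_inv_smul, ← mul_smul,
            (hu.zpow_right _).symm.eq, mul_assoc, ← zpow_natCast, ← zpow_add, neg_add_cancel,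
            zpow_zero, mul_one, dist_comm]
        rw [e1, e2]
        exact hmin _) n
    have e1 : dist (u⁻¹ • x) x = dist (u • x) x := by
      rw [← dist_smul u, smul_inv_smul, dist_comm]
    have e2 : dist (u⁻¹ • x) (h ^ n • x) = dist x (u • h ^ n • x) := by
      rw [← dist_smul u, smul_inv_smul]
    rw [e1, e2] at h2
    -- In the quadrilateral `u • x`, `x`, `h ^ n • x`, `u • h ^ n • x`, opposite sides are equal
    -- and, up to `2 * Q`, both diagonals are at least the sum of two adjacent sides. As `n` makes
    -- one side longer than `2 * Q + δ`, the other must be short.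
    have h3 := h4 (u • x) x (h ^ n • x) (u • h ^ n • x)
    rw [dist_smul, dist_comm (h ^ n • x) (u • h ^ n • x)] at h3
    have e3 : dist (u • h ^ n • x) (h ^ n • x) = dist (u • x) x := by
      rw [← mul_smul, (hu.pow_right n).eq, mul_smul, dist_smul]
    rw [e3] at h3
    rw [dist_comm x (u • x)]
    rcases le_max_iff.1 (sub_le_iff_le_add.2 h3) with h5 | h5 <;> linarith
  -- The infimum over the orbit need not be attained, hence the slack 1 in `short`.
  have near : ∀ j : ℕ, ∃ k : ℤ, dist x ((h ^ k * c ^ j) • x) ≤ 2 * Q + δ := by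
    intro j
    have hbdd : BddBelow (Set.range fun k : ℤ => dist (c ^ j • x) (h ^ k • x)) :=
      ⟨0, by rintro _ ⟨k, rfl⟩; exact dist_nonneg⟩
    obtain ⟨k, hk⟩ := exists_lt_of_ciInf_lt
      (lt_add_one (⨅ k : ℤ, dist (c ^ j • x) (h ^ k • x)))
    refine ⟨-k, short _ ((((Commute.refl h).zpow_left _).mul_left (hch.pow_left j))) fun l => ?_⟩
    have h1 := ciInf_le hbdd (k + l)
    have e1 : dist ((h ^ (-k) * c ^ j) • x) x = dist (c ^ j • x) (h ^ k • x) := by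
      rw [← dist_smul (h ^ k), ← mul_smul, ← mul_assoc, ← zpow_add]
      simp
    have e2 : dist ((h ^ (-k) * c ^ j) • x) (h ^ l • x) = dist (c ^ j • x) (h ^ (k + l) • x) := by
      rw [← dist_smul (h ^ k), ← mul_smul, ← mul_assoc, ← zpow_add, ← mul_smul, ← zpow_add]
      simp
    rw [e1, e2]
    linarith
  choose k hk using near
  obtain ⟨N, R, -, hR, hN⟩ := hac (2 * Q + δ) (by linarith)
  obtain ⟨n, hn⟩ := exists_nat_gt R
  have hfin := hN x (h ^ (n + 1) • x) (by linarith [hlin n])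
  -- The corrected powers commute with `h`, so they move `h ^ (n + 1) • x` exactly as far as `x`.
  have hmem : ∀ j, h ^ k j * c ^ j ∈ {g : G | dist x (g • x) ≤ 2 * Q + δ ∧
      dist (h ^ (n + 1) • x) (g • h ^ (n + 1) • x) ≤ 2 * Q + δ} := by
    intro j
    refine ⟨hk j, ?_⟩
    have hcomm : Commute (h ^ k j * c ^ j) h :=
      ((Commute.refl h).zpow_left _).mul_left (hch.pow_left j)
    rw [← mul_smul, (hcomm.pow_right _).eq, mul_smul, dist_smul]
    exact hk j
  have hfin' := Set.finite_of_encard_le_coe hfin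
  obtain ⟨i, j, hij, hne⟩ : ∃ i j : ℕ, i < j ∧ h ^ k i * c ^ i = h ^ k j * c ^ j := by
    by_contra! hcon
    have hinj : Function.Injective fun j : ℕ => h ^ k j * c ^ j := by
      intro i j hij
      rcases lt_trichotomy i j with hlt | rfl | hlt
      · exact absurd hij (hcon i j hlt)
      · rfl
      · exact absurd hij.symm (hcon j i hlt)
    exact (Set.infinite_range_of_injective hinj) (hfin'.subset (Set.range_subset_iff.2 hmem))
  obtain ⟨d, rfl⟩ := Nat.exists_eq_add_of_lt hij
  refine ⟨d + 1, Nat.succ_pos d, m * (k i - k (i + d + 1)), ?_⟩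
  have e : c ^ (d + 1) = h ^ (k i - k (i + d + 1)) := by
    rw [add_assoc, add_comm i, pow_add, ← mul_assoc] at hne
    have := mul_right_cancel hne
    rw [add_assoc, sub_eq_neg_add, zpow_add, this, add_comm i, ← mul_assoc, ← zpow_add]
    simp
  rw [e, hdef, zpow_mul, zpow_natCast]

/-- A single loxodromic element gives the contradiction; it is nontrivial because its displacement
grows. -/
theorem not_acylindricallyHyperbolic_of_commute.{u₁, u₂} {G : Type u₁} [Group G]
    (hG : ∀ g : G, g ≠ 1 → ∃ c, Commute c g ∧ ∀ n : ℕ, 0 < n → ∀ k : ℤ, c ^ n ≠ g ^ k) :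
    ¬ AcylindricallyHyperbolic.{u₁, u₂} G := by
  rintro ⟨X, _, _, hX, -, _, hac, g, -, hg, -⟩
  have hg1 : g ≠ 1 := by
    rintro rfl
    obtain ⟨x, hx⟩ := hg.exists_gain
    obtain ⟨m, hm⟩ := hx 1
    norm_num at hm
  obtain ⟨c, hc, hcn⟩ := hG g hg1
  obtain ⟨n, hn, k, hk⟩ := hg.exists_pow_eq_zpow_of_commute hX hac hc
  exact hcn n hn k hk

end Loxodromic

/-! ### Ultrapowers -/

section Ultrapower

open FirstOrder FirstOrder.Language

variable {I : Type*} (U : Ultrafilter I) (G : Type*) [Group G]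

/-- The ultrapower as a model-theoretic ultraproduct is the ultrapower as a group of germs. -/
def productEquivGerm : (U : Filter I).Product (fun _ => G) ≃[groupLanguage] Germ (U : Filter I) G where
  toFun := Quotient.map' id fun _ _ h => h
  invFun := Quotient.map' id fun _ _ h => h
  left_inv := by rintro ⟨x⟩; rfl
  right_inv := by rintro ⟨x⟩; rfl
  map_fun' := by
    intro n f x
    obtain ⟨x, rfl⟩ : ∃ y : Fin n → I → G, x = fun i => Quotient.mk'' (y i) :=
      ⟨fun i => (x i).out, funext fun i => (Quotient.out_eq' _).symm⟩
    refine (congrArg _ (Ultraproduct.funMap_cast f x)).trans ?_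
    cases f <;> rfl
  map_rel' := by intro n r; exact r.elim

/-- **Łoś's theorem**: the diagonal embedding of a group in its ultrapower is elementary. -/
def diagonalElementaryEmbedding : G ↪ₑ[groupLanguage] Germ (U : Filter I) G where
  toFun g := (↑g : Germ (U : Filter I) G)
  map_formula' := by
    intro n φ x
    have h1 := (productEquivGerm U G).toElementaryEmbedding.map_formula φ
      (fun i => Quotient.mk'' (fun _ => x i))
    have h2 := Ultraproduct.realize_formula_cast (u := U) (M := fun _ : I => G) φ
      (fun i _ => x i)
    refine h1.trans (h2.trans ?_)
    simp

variable {U}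

/-- For sets `s n` in `U` whose intersection is not in `U`, take `φ i` to be the first `n` with `i ∉
s n`. The default 0 is used only on the intersection, which is negligible. -/
theorem exists_tendsto_atTop_of_not_countableInter (hU : ¬ CountableInterFilter (U : Filter I)) :
    ∃ φ : I → ℕ, Tendsto φ U atTop := by
  classical
  obtain ⟨S, hSc, hS, hS'⟩ : ∃ S : Set (Set I), S.Countable ∧ (∀ s ∈ S, s ∈ U) ∧ ⋂₀ S ∉ U := by
    by_contra! h
    exact hU ⟨fun S hc hS => h S hc hS⟩
  have hne : S.Nonempty := by
    rw [Set.nonempty_iff_ne_empty]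
    rintro rfl
    exact hS' (by rw [Set.sInter_empty]; exact univ_mem)
  obtain ⟨s, rfl⟩ := hSc.exists_eq_range hne
  have hs : ∀ n, s n ∈ U := fun n => hS _ ⟨n, rfl⟩
  have hc : (⋂₀ Set.range s)ᶜ ∈ U := Ultrafilter.compl_mem_iff_notMem.2 hS'
  refine ⟨fun i => if h : ∃ n, i ∉ s n then Nat.find h else 0, tendsto_atTop.2 fun n => ?_⟩
  have hn : ∀ᶠ i in (U : Filter I), ∀ k ∈ Set.Iio n, i ∈ s k :=
    (eventually_all_finite (Set.finite_Iio n)).2 fun k _ => hs k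
  filter_upwards [hn, hc] with i h1 h2
  have hex : ∃ n, i ∉ s n := by simpa using h2
  rw [dif_pos hex, Nat.le_find_iff]
  intro k hk
  exact not_not.2 (h1 k hk)

theorem not_countableInterFilter_of_countable [Countable I] (hU : ∀ i, U ≠ pure i) :
    ¬ CountableInterFilter (U : Filter I) := by
  intro h
  have h1 : ∀ᶠ j in (U : Filter I), ∀ i : I, j ≠ i := by
    rw [eventually_countable_forall]
    intro i
    by_contra hi
    apply hU i
    have hi' : {i} ∈ U := by
      have : {j | j ≠ i} ∉ U := hi
      rw [← Ultrafilter.compl_mem_iff_notMem] at this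
      convert this using 1
      ext; simp
    exact Ultrafilter.coe_le_coe.1 (by simpa using hi')
  obtain ⟨j, hj⟩ := h1.exists
  exact hj j rfl

variable {G}

theorem zpow_right_injective_of_ne_one [IsMulTorsionFree G] {g : G} (hg : g ≠ 1) :
    Function.Injective fun n : ℤ => g ^ n := by
  rw [injective_zpow_iff_not_isOfFinOrder, isOfFinOrder_iff_pow_eq_one]
  rintro ⟨n, hn, h⟩
  exact hg ((pow_eq_one_iff_left hn.ne').1 h)

/-- In an ultrapower of a torsion-free group, every nontrivial element commutes with an element
no power of which lies in the cyclic subgroup it generates. -/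
theorem exists_commute_pow_ne_zpow [IsMulTorsionFree G] {φ : I → ℕ} (hφ : Tendsto φ U atTop)
    (g : Germ (U : Filter I) G) (hg : g ≠ 1) :
    ∃ c, Commute c g ∧ ∀ n : ℕ, 0 < n → ∀ k : ℤ, c ^ n ≠ g ^ k := by
  induction g using Germ.inductionOn with | _ g
  -- A relation `c ^ n = g ^ k` would force `φ i * n = k` in a coordinate with `φ i > k`.
  refine ⟨((fun i => g i ^ φ i : I → G) : Germ (U : Filter I) G), ?_, fun n hn k h => ?_⟩
  · change ((fun i => g i ^ φ i * g i : I → G) : Germ (U : Filter I) G) =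
      ((fun i => g i * g i ^ φ i : I → G) : Germ (U : Filter I) G)
    congr 1
    funext i
    rw [← pow_succ, ← pow_succ']
  · have h' : ∀ᶠ i in (U : Filter I), (g i ^ φ i) ^ n = g i ^ k := Germ.coe_eq.1 h
    have hg' : ∀ᶠ i in (U : Filter I), g i ≠ 1 := by
      refine Ultrafilter.eventually_not.2 fun h1 => hg (Germ.coe_eq.2 h1)
    obtain ⟨i, h1, h2, h3⟩ := (h'.and (hg'.and (hφ.eventually_gt_atTop k.toNat))).exists
    rw [← pow_mul, ← zpow_natCast] at h1
    have h4 := zpow_right_injective_of_ne_one h2 h1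
    push_cast at h4
    have h5 : (φ i : ℤ) ≤ φ i * n := le_mul_of_one_le_right (by positivity) (by exact_mod_cast hn)
    omega

/-- Diagonalization: given a list of germs, coordinate `i` avoids the values of the first `φ i` of
them, among the infinitely many powers of a nontrivial element commuting with `g i`. The `n`-th germ
is then avoided wherever `φ i > n`. -/
theorem uncountable_centralizer_germ [IsMulTorsionFree G] [Nontrivial G] {φ : I → ℕ}
    (hφ : Tendsto φ U atTop) (g : Germ (U : Filter I) G) :
    Uncountable (Subgroup.centralizer {g}) := by
  classical
  induction g using Germ.inductionOn with | _ g
  have hz : ∀ i, ∃ z : G, z ≠ 1 ∧ Commute z (g i) := by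
    intro i
    by_cases hi : g i = 1
    · obtain ⟨z, hz⟩ := exists_ne (1 : G)
      exact ⟨z, hz, hi ▸ Commute.one_right z⟩
    · exact ⟨g i, hi, Commute.refl _⟩
  choose z hz1 hzc using hz
  have hmem : ∀ e : I → ℕ, ((fun i => z i ^ e i : I → G) : Germ (U : Filter I) G) ∈
      Subgroup.centralizer {(g : Germ (U : Filter I) G)} := by
    intro e
    rw [Subgroup.mem_centralizer_singleton_iff]
    change ((fun i => z i ^ e i * g i : I → G) : Germ (U : Filter I) G) =
      ((fun i => g i * z i ^ e i : I → G) : Germ (U : Filter I) G)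
    congr 1
    funext i
    exact ((hzc i).pow_left _).eq
  rw [← not_countable_iff]
  intro hcount
  obtain ⟨F, hF⟩ := exists_surjective_nat (Subgroup.centralizer {(g : Germ (U : Filter I) G)})
  have hrep : ∀ n, ∃ f : I → G, (f : Germ (U : Filter I) G) = F n :=
    fun n => Quotient.exists_rep (F n : Germ (U : Filter I) G)
  choose f hf using hrep
  have havoid : ∀ i, ∃ e : ℕ, z i ^ e ∉ (Finset.range (φ i)).image fun n => f n i := by
    intro i
    by_contra! h
    have hinj : Function.Injective fun e : ℕ => z i ^ e := by
      intro a b hab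
      have := zpow_right_injective_of_ne_one (hz1 i) (a₁ := (a : ℤ)) (a₂ := b) (by simpa using hab)
      exact_mod_cast this
    exact Set.infinite_range_of_injective hinj
      ((Finset.finite_toSet _).subset (Set.range_subset_iff.2 h))
  choose e he using havoid
  obtain ⟨n, hn⟩ := hF ⟨_, hmem e⟩
  have h1 : (f n : Germ (U : Filter I) G) = ((fun i => z i ^ e i : I → G) : Germ (U : Filter I) G) := by
    rw [hf, hn]
  obtain ⟨i, h2, h3⟩ := ((Germ.coe_eq.1 h1).and (hφ.eventually_gt_atTop n)).exists
  exact he i (Finset.mem_image.2 ⟨n, Finset.mem_range.2 h3, h2⟩)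

theorem not_isOfFinOrder_germ [IsMulTorsionFree G] (g : Germ (U : Filter I) G) (hg : g ≠ 1) :
    ¬ IsOfFinOrder g := by
  induction g using Germ.inductionOn with | _ g
  rw [isOfFinOrder_iff_pow_eq_one]
  rintro ⟨n, hn, h⟩
  apply hg
  have h' : ∀ᶠ i in (U : Filter I), g i ^ n = 1 := Germ.coe_eq.1 h
  exact Germ.coe_eq.2 (h'.mono fun i hi => (pow_eq_one_iff_left hn.ne').1 hi)

end Ultrapower

/-! ### Countable elementary subgroups that are not finitely generated -/

section ElementarySubgroup

open FirstOrder FirstOrder.Language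

theorem countable_groupLanguage_boundedFormula :
    Countable (Σ n, groupLanguage.BoundedFormula Empty n) := by
  have hf : Countable (Σ n, groupLanguage.Functions n) := by
    have : ∀ n, Countable (GroupFunc n) := fun n =>
      Function.Injective.countable (f := fun f : GroupFunc n => match f with
        | .mul => (0 : ℕ) | .inv => 1 | .one => 2) (by
          intro a b h; cases a <;> cases b <;> simp_all)
    exact inferInstanceAs (Countable (Σ n, GroupFunc n))
  have hr : Countable (Σ n, groupLanguage.Relations n) :=
    inferInstanceAs (Countable (Σ _ : ℕ, Empty))
  have hs : Countable groupLanguage.Symbols :=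
    inferInstanceAs (Countable ((Σ n, groupLanguage.Functions n) ⊕ Σ n, groupLanguage.Relations n))
  rw [← Cardinal.mk_le_aleph0_iff]
  refine BoundedFormula.card_le.trans (max_le le_rfl ?_)
  have : groupLanguage.card ≤ Cardinal.aleph0 := Cardinal.mk_le_aleph0_iff.2 hs
  simpa using this

theorem Subgroup.countable_closure {M : Type*} [Group M] {S : Set M} (hS : S.Countable) :
    (Subgroup.closure S : Set M).Countable := by
  have : Countable S := hS.to_subtype
  have : Countable (FreeGroup S) :=
    Quot.mk_surjective.countable (f := (Quot.mk _ : List (S × Bool) → FreeGroup S))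
  rw [FreeGroup.closure_eq_range]
  exact Set.countable_range (FreeGroup.lift ((↑) : S → M))

variable {M : Type*} [Group M]

/-- One stage of the chain: adjoin the values of `c`, a Tarski–Vaught witness for each formula with
parameters in `H`, and a point outside `H` for strictness. -/
theorem exists_countable_witnessing_subgroup [Uncountable M] (c : M → M) (H : Subgroup M)
    (hH : (H : Set M).Countable) :
    ∃ K : Subgroup M, (K : Set M).Countable ∧ H < K ∧ (∀ g ∈ H, c g ∈ K) ∧
      ∀ (n : ℕ) (φ : groupLanguage.BoundedFormula Empty (n + 1)) (x : Fin n → H) (a : M),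
        φ.Realize default (Fin.snoc (fun i => (x i : M)) a : _ → M) →
          ∃ b ∈ K, φ.Realize default (Fin.snoc (fun i => (x i : M)) b : _ → M) := by
  classical
  obtain ⟨z, hz⟩ : ∃ z, z ∉ H := by
    by_contra! h
    exact not_countable (α := M) (Set.countable_univ_iff.1 (hH.mono fun x _ => h x))
  have := countable_groupLanguage_boundedFormula
  have : Countable H := hH.to_subtype
  have hcount : Countable (Σ n, groupLanguage.BoundedFormula Empty (n + 1) × (Fin n → H)) := by
    have : ∀ n, Countable (groupLanguage.BoundedFormula Empty n) := fun n =>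
      Function.Injective.countable (f := fun φ : groupLanguage.BoundedFormula Empty n =>
        (⟨n, φ⟩ : Σ n, groupLanguage.BoundedFormula Empty n)) sigma_mk_injective
    infer_instance
  let w : (Σ n, groupLanguage.BoundedFormula Empty (n + 1) × (Fin n → H)) → M := fun p =>
    Classical.epsilon fun a =>
      p.2.1.Realize default (Fin.snoc (fun i => (p.2.2 i : M)) a : _ → M)
  let S : Set M := (H : Set M) ∪ (c '' H ∪ (Set.range w ∪ {z}))
  have hS : S.Countable :=
    hH.union ((hH.image c).union ((Set.countable_range w).union (Set.countable_singleton z)))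
  have hsub : S ⊆ Subgroup.closure S := Subgroup.subset_closure
  refine ⟨Subgroup.closure S, ?_, ?_, fun g hg => ?_, fun n φ x a ha => ?_⟩
  · exact Subgroup.countable_closure hS
  · refine lt_of_le_of_ne (fun g hg => hsub (Or.inl hg)) fun h => hz ?_
    rw [h]
    exact hsub (by simp [S])
  · exact hsub (Or.inr (Or.inl ⟨g, hg, rfl⟩))
  · refine ⟨w ⟨n, φ, x⟩, hsub (Or.inr (Or.inr (Or.inl ⟨_, rfl⟩))), ?_⟩
    exact Classical.epsilon_spec
      (p := fun a => φ.Realize default (Fin.snoc (fun i => (x i : M)) a : _ → M)) ⟨a, ha⟩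

/-- In the union of the chain, any finite tuple lies in one stage. For parameters this gives the
Tarski–Vaught criterion at the next stage; for generators it contradicts strictness. -/
theorem exists_elementary_subgroup_not_fg [Uncountable M] (c : M → M) (B : Set M)
    (hB : B.Countable) :
    ∃ H : Subgroup M, B ⊆ H ∧ Countable H ∧ (∀ g ∈ H, c g ∈ H) ∧ ¬ Group.FG H ∧
      ∃ f : H ↪ₑ[groupLanguage] M, ∀ x, f x = x := by
  classical
  choose! next hcount hlt hc hw using
    fun (H : Subgroup M) (hH : (H : Set M).Countable) => exists_countable_witnessing_subgroup c H hH
  let H : ℕ → Subgroup M := fun n => next^[n] (Subgroup.closure B)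
  have hsucc : ∀ n, H (n + 1) = next (H n) := fun n => Function.iterate_succ_apply' _ _ _
  have hHc : ∀ n, (H n : Set M).Countable := by
    intro n
    induction n with
    | zero => exact Subgroup.countable_closure hB
    | succ n ih => rw [hsucc]; exact hcount _ ih
  have hmono : StrictMono H := strictMono_nat_of_lt_succ fun n => by
    rw [hsucc]; exact hlt _ (hHc n)
  have hdir : Directed (· ≤ ·) H := hmono.monotone.directed_le
  have hmem : ∀ {x}, x ∈ ⨆ n, H n ↔ ∃ n, x ∈ H n := Subgroup.mem_iSup_of_directed hdir
  have hle : ∀ n, H n ≤ ⨆ n, H n := le_iSup H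
  let f : (⨆ n, H n : Subgroup M) ↪[groupLanguage] M :=
    { toFun := Subtype.val
      inj' := Subtype.val_injective
      map_fun' := by intro n f x; cases f <;> rfl
      map_rel' := by intro n r; exact r.elim }
  refine ⟨⨆ n, H n, fun b hb => hle 0 (Subgroup.subset_closure hb), ?_, fun g hg => ?_, ?_,
    ⟨f.toElementaryEmbedding ?_, fun _ => rfl⟩⟩
  · have : ((⨆ n, H n : Subgroup M) : Set M) = ⋃ n, (H n : Set M) := by
      ext x; simp [hmem]
    exact Set.countable_coe_iff.2 (this ▸ Set.countable_iUnion hHc)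
  · obtain ⟨n, hn⟩ := hmem.1 hg
    exact hle (n + 1) (by rw [hsucc]; exact hc _ (hHc n) _ hn)
  · rw [Group.fg_iff_subgroup_fg]
    rintro ⟨S, hS⟩
    have hS' : (S : Set M) ⊆ ⋃ n, (H n : Set M) := fun x hx =>
      Set.mem_iUnion.2 (hmem.1 (hS ▸ Subgroup.subset_closure hx))
    obtain ⟨n, hn⟩ := Directed.exists_mem_subset_of_finset_subset_biUnion
      (f := fun n => (H n : Set M)) hdir hS'
    have h1 : (⨆ n, H n) ≤ H n := hS ▸ (Subgroup.closure_le _).2 hn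
    exact absurd ((hle (n + 1)).trans h1) (not_le_of_gt (hmono n.lt_succ_self))
  · intro n φ x a ha
    have hx : ∃ k, ∀ i, (x i : M) ∈ H k := by
      choose k hk using fun i => hmem.1 (x i).2
      exact ⟨Finset.univ.sup k, fun i =>
        hmono.monotone (Finset.le_sup (Finset.mem_univ i)) (hk i)⟩
    obtain ⟨k, hk⟩ := hx
    obtain ⟨b, hb, hb'⟩ := hw _ (hHc k) n φ (fun i => ⟨x i, hk i⟩) a ha
    exact ⟨⟨b, hle (k + 1) (by rw [hsucc]; exact hb)⟩, hb'⟩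

/-- An elementary embedding whose image lies in an elementarily embedded subgroup corestricts. -/
theorem nonempty_elementaryEmbedding_corestrict {F : Type*} [Group F]
    (d : F ↪ₑ[groupLanguage] M) {H : Subgroup M} (f : H ↪ₑ[groupLanguage] M)
    (hf : ∀ x, f x = x) (hd : ∀ x, d x ∈ H) : Nonempty (F ↪ₑ[groupLanguage] H) := by
  refine ⟨⟨fun x => ⟨d x, hd x⟩, fun n φ x => ?_⟩⟩
  rw [← f.map_formula, ← d.map_formula]
  have : f ∘ (fun x => (⟨d x, hd x⟩ : H)) ∘ x = d ∘ x := by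
    funext i; simp [hf]
  rw [this]

end ElementarySubgroup

/-! ### Noncyclic centralizers and the countable elementary extension -/

section ElementaryExtension

open FirstOrder FirstOrder.Language

/-- If `g = z ^ m` and `c = z ^ n` with `m ≠ 0`, then `c ^ |m|` is a power of `g`. For `g = 1` the
centralizer is the whole nonabelian group. -/
theorem not_isCyclic_centralizer {G : Type*} [Group G] (hnc : ∃ a b : G, a * b ≠ b * a)
    (hG : ∀ g : G, g ≠ 1 → ∃ c, Commute c g ∧ ∀ n : ℕ, 0 < n → ∀ k : ℤ, c ^ n ≠ g ^ k) (g : G) :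
    ¬ IsCyclic (Subgroup.centralizer {g}) := by
  rintro ⟨⟨z, hz⟩, hgen⟩
  have hz' : ∀ x, x * g = g * x → ∃ n : ℤ, z ^ n = x := by
    intro x hx
    obtain ⟨n, hn⟩ := hgen ⟨x, Subgroup.mem_centralizer_singleton_iff.2 hx⟩
    exact ⟨n, congrArg Subtype.val hn⟩
  by_cases hg : g = 1
  · subst hg
    obtain ⟨a, b, hab⟩ := hnc
    obtain ⟨m, rfl⟩ := hz' a (by simp)
    obtain ⟨n, rfl⟩ := hz' b (by simp)
    exact hab (by rw [← zpow_add, ← zpow_add, add_comm])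
  · obtain ⟨c, hc, hcn⟩ := hG g hg
    obtain ⟨m, rfl⟩ := hz' g rfl
    obtain ⟨n, rfl⟩ := hz' c hc
    have hm : m ≠ 0 := by rintro rfl; simp at hg
    refine hcn m.natAbs (Int.natAbs_pos.2 hm) (n * m.sign) ?_
    rw [← zpow_natCast, ← zpow_mul, ← zpow_mul, Int.natCast_natAbs, ← Int.sign_mul_self_eq_abs]
    congr 1
    ring

theorem exists_elementary_extension.{u₂} (F : Type) [Group F] [Countable F] [IsMulTorsionFree F]
    (hF : ∃ a b : F, a * b ≠ b * a) :
    ∃ (G : Type) (_ : Group G),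
      Nonempty (F ↪ₑ[groupLanguage] G) ∧ Countable G ∧
      (∀ g : G, g ≠ 1 → ¬ IsOfFinOrder g) ∧ ¬ Group.FG G ∧
      (∀ g : G, ¬ IsCyclic (Subgroup.centralizer {g})) ∧
      ¬ AcylindricallyHyperbolic.{0, u₂} G := by
  classical
  have : Nontrivial F := by
    obtain ⟨a, b, hab⟩ := hF
    refine ⟨a * b, b * a, hab⟩
  let U := hyperfilter ℕ
  have hU : ¬ CountableInterFilter (U : Filter ℕ) := not_countableInterFilter_of_countable
    fun i h => by
      have h1 : {i} ∈ U := h ▸ Ultrafilter.mem_pure.2 rfl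
      exact (notMem_hyperfilter_of_finite (Set.finite_singleton i)) h1
  obtain ⟨φ, hφ⟩ := exists_tendsto_atTop_of_not_countableInter hU
  let M := Germ (U : Filter ℕ) F
  have hM : Uncountable M := by
    have := uncountable_centralizer_germ hφ (1 : M)
    exact Subtype.val_injective.uncountable (f := fun x : Subgroup.centralizer {(1 : M)} => x.1)
  -- Having no power in `⟨g⟩` is not a single first-order condition on `c`, so the choice of `c` is
  -- built into the subgroup explicitly.
  choose! c hc hcn using exists_commute_pow_ne_zpow (G := F) hφ
  let d := diagonalElementaryEmbedding U F
  obtain ⟨H, hB, hcount, hcH, hfg, f, hf⟩ :=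
    exists_elementary_subgroup_not_fg c (Set.range d) (Set.countable_range d)
  have hd : ∀ x, d x ∈ H := fun x => hB ⟨x, rfl⟩
  have hne : ∀ g : H, g ≠ 1 → (g : M) ≠ 1 := fun g hg h => hg (Subtype.ext h)
  have htf : ∀ g : H, g ≠ 1 → ¬ IsOfFinOrder g := fun g hg h =>
    not_isOfFinOrder_germ (g : M) (hne g hg) (Submonoid.isOfFinOrder_coe.2 h)
  have hG : ∀ g : H, g ≠ 1 → ∃ c, Commute c g ∧ ∀ n : ℕ, 0 < n → ∀ k : ℤ, c ^ n ≠ g ^ k := by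
    intro g hg
    refine ⟨⟨c g, hcH _ g.2⟩, Subtype.ext (hc g (hne g hg)), fun n hn k h => ?_⟩
    exact hcn g (hne g hg) n hn k (by simpa using congrArg Subtype.val h)
  have hnc : ∃ a b : H, a * b ≠ b * a := by
    obtain ⟨a, b, hab⟩ := hF
    refine ⟨⟨d a, hd a⟩, ⟨d b, hd b⟩, fun h => hab ?_⟩
    exact d.injective (congrArg Subtype.val h)
  exact ⟨H, inferInstance, nonempty_elementaryEmbedding_corestrict d f hf hd, hcount, htf, hfg,
    not_isCyclic_centralizer hnc hG, not_acylindricallyHyperbolic_of_commute hG⟩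

end ElementaryExtension

/-! ### The real tree spanned by a 0-hyperbolic space -/

section TreeHull

variable {V : Type*} [MetricSpace V]

/-- The distance function to the point at distance `t` from `a` on a segment from `a` to `b` in
a real tree containing `V`. -/
def treePoint (a b : V) (t : ℝ) : V → ℝ := fun w => max (dist a w - t) (dist b w - (dist a b - t))

variable (V) in
/-- The points of the real tree spanned by a 0-hyperbolic space `V`, each given by its distance
function to `V`. -/
def TreeHull : Type _ :=
  {f : V → ℝ // ∃ (a b : V) (t : ℝ), 0 ≤ t ∧ t ≤ dist a b ∧ f = treePoint a b t}

namespace TreeHull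

theorem bddAbove_abs_sub (f g : TreeHull V) : BddAbove (Set.range fun w => |f.1 w - g.1 w|) := by
  obtain ⟨_, a, b, s, hs0, hs, rfl⟩ := f
  obtain ⟨_, a', b', t, ht0, ht, rfl⟩ := g
  refine ⟨s + t + dist a a', ?_⟩
  rintro _ ⟨w, rfl⟩
  have bound : ∀ (a b : V) (t : ℝ), 0 ≤ t → t ≤ dist a b → |treePoint a b t w - dist a w| ≤ t := by
    intro a b t h0 h
    have h1 := dist_triangle b a w
    rw [dist_comm b a] at h1
    rw [abs_le, treePoint]
    exact ⟨by linarith [le_max_left (dist a w - t) (dist b w - (dist a b - t))],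
      by rw [sub_le_iff_le_add]; exact max_le (by linarith) (by linarith)⟩
  have h1 := abs_le.1 (bound a b s hs0 hs)
  have h2 := abs_le.1 (bound a' b' t ht0 ht)
  have h3 := abs_le.1 (abs_dist_sub_le a a' w)
  rw [abs_le]
  constructor <;> linarith [h1.1, h1.2, h2.1, h2.2, h3.1, h3.2]

theorem nonempty_base (f : TreeHull V) : Nonempty V := by
  obtain ⟨_, a, -⟩ := f
  exact ⟨a⟩

noncomputable instance : MetricSpace (TreeHull V) where
  dist f g := ⨆ w, |f.1 w - g.1 w|
  dist_self f := by simp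
  dist_comm f g := by simp only [abs_sub_comm]
  dist_triangle f g h := by
    have := f.nonempty_base
    refine ciSup_le fun w => ?_
    exact (abs_sub_le _ (g.1 w) _).trans
      (add_le_add (le_ciSup (bddAbove_abs_sub f g) w) (le_ciSup (bddAbove_abs_sub g h) w))
  eq_of_dist_eq_zero {f g} h := by
    refine Subtype.ext (funext fun w => ?_)
    have := le_ciSup (bddAbove_abs_sub f g) w
    rw [h] at this
    exact sub_eq_zero.1 (abs_nonpos_iff.1 this)

theorem dist_def (f g : TreeHull V) : dist f g = ⨆ w, |f.1 w - g.1 w| := rfl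

section Action

variable {G : Type*} [Group G] [MulAction G V] [IsIsometricSMul G V]

theorem dist_inv_smul_right (g : G) (a w : V) : dist a (g⁻¹ • w) = dist (g • a) w := by
  rw [← dist_smul g, smul_inv_smul]

instance : MulAction G (TreeHull V) where
  smul g f := ⟨fun w => f.1 (g⁻¹ • w), by
    obtain ⟨_, a, b, t, h0, h, rfl⟩ := f
    refine ⟨g • a, g • b, t, h0, by rwa [dist_smul], ?_⟩
    funext w
    simp only [treePoint, dist_inv_smul_right, dist_smul]⟩
  one_smul f := Subtype.ext (funext fun w => by
    change f.1 ((1 : G)⁻¹ • w) = f.1 w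
    simp)
  mul_smul g h f := Subtype.ext (funext fun w => by
    change f.1 ((g * h)⁻¹ • w) = f.1 (h⁻¹ • g⁻¹ • w)
    rw [mul_inv_rev, mul_smul])

theorem smul_val (g : G) (f : TreeHull V) (w : V) : (g • f).1 w = f.1 (g⁻¹ • w) := rfl

instance : IsIsometricSMul G (TreeHull V) where
  isometry_smul g := Isometry.of_dist_eq fun f f' => by
    simp only [dist_def, smul_val]
    exact (MulAction.toPerm g⁻¹).iSup_comp (g := fun w => |f.1 w - f'.1 w|)

end Action

/-- The point at distance `t` from `o` on the segment from `o` to `x`. -/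
def mk (o x : V) (t : ℝ) (h0 : 0 ≤ t) (h : t ≤ dist o x) : TreeHull V :=
  ⟨treePoint o x t, o, x, t, h0, h, rfl⟩

/-- The isometric embedding of `V` in the tree that it spans. -/
def ofPoint (v : V) : TreeHull V := mk v v 0 le_rfl dist_nonneg

theorem ofPoint_val (v w : V) : (ofPoint v).1 w = dist v w := by simp [ofPoint, mk, treePoint]

theorem dist_ofPoint (u v : V) : dist (ofPoint u) (ofPoint v) = dist u v := by
  have : Nonempty V := ⟨u⟩
  refine le_antisymm (ciSup_le fun w => ?_) ?_
  · simp only [ofPoint_val]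
    exact abs_dist_sub_le u v w
  · have h : |(ofPoint u).1 v - (ofPoint v).1 v| ≤ dist (ofPoint u) (ofPoint v) :=
      le_ciSup (bddAbove_abs_sub (ofPoint u) (ofPoint v)) v
    rwa [ofPoint_val, ofPoint_val, dist_self, sub_zero, abs_of_nonneg dist_nonneg] at h

theorem smul_ofPoint {G : Type*} [Group G] [MulAction G V] [IsIsometricSMul G V] (g : G) (v : V) :
    g • ofPoint v = ofPoint (g • v) :=
  Subtype.ext (funext fun w => by rw [smul_val, ofPoint_val, ofPoint_val, dist_inv_smul_right])

/-- The segments from `o` to `x` and to `w` separate at height `gromovProduct o x w`. -/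
theorem treePoint_eq (o x : V) (t : ℝ) (w : V) :
    treePoint o x t w = t + dist o w - 2 * min t (gromovProduct o x w) := by
  rw [treePoint, gromovProduct]
  rcases le_total t ((dist o x + dist o w - dist x w) / 2) with h | h
  · rw [min_eq_left h, max_eq_left (by linarith)]; ring
  · rw [min_eq_right h, max_eq_right (by linarith)]; ring

section ZeroHyperbolic

variable (hV : ∀ x y z w : V, dist x z + dist y w ≤ max (dist x y + dist z w) (dist x w + dist y z))
include hV

theorem gromovProduct_ultrametric (o x y z : V) :
    min (gromovProduct o x y) (gromovProduct o y z) ≤ gromovProduct o x z := by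
  have h := hV x y z o
  simp only [gromovProduct, dist_comm o] at *
  rcases le_max_iff.1 h with h | h
  · exact (min_le_left _ _).trans (by linarith)
  · exact (min_le_right _ _).trans (by linarith)

/-- A segment from `a` to `b` is covered by those from `o` to `a` and from `o` to `b`; the larger
term of `treePoint` at `o` decides which one contains the point. -/
theorem exists_eq_mk (o : V) (f : TreeHull V) :
    ∃ x t, ∃ (h0 : 0 ≤ t) (h : t ≤ dist o x), f = mk o x t h0 h := by
  have key : ∀ (a b : V) (t : ℝ), 0 ≤ t → t ≤ dist a b →
      dist b o - (dist a b - t) ≤ dist a o - t →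
      ∃ r, 0 ≤ r ∧ r ≤ dist o a ∧ treePoint a b t = treePoint o a r := by
    intro a b t h0 h hle
    have htri := dist_triangle a o b
    rw [dist_comm o b] at htri
    refine ⟨dist a o - t, by linarith, by rw [dist_comm o a]; linarith, funext fun w => ?_⟩
    have h1 := hV a w b o
    have h2 := hV a b w o
    have h3 := hV a b o w
    simp only [treePoint, dist_comm o a]
    rw [dist_comm w o, dist_comm w b] at h1
    rw [dist_comm w o] at h2
    rw [max_comm (dist o w - _), show dist a w - (dist a o - (dist a o - t)) = dist a w - t by ring]
    apply le_antisymm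
    · refine max_le (le_max_left _ _) ?_
      rcases le_max_iff.1 h3 with h3 | h3
      · exact (by linarith : _ ≤ _).trans (le_max_right _ _)
      · exact (by linarith : _ ≤ _).trans (le_max_left _ _)
    · refine max_le (le_max_left _ _) ?_
      rcases le_max_iff.1 h1 with h1 | h1
      · exact (by linarith : _ ≤ _).trans (le_max_left _ _)
      · exact (by linarith : _ ≤ _).trans (le_max_right _ _)
  obtain ⟨_, a, b, t, h0, h, rfl⟩ := f
  rcases le_total (dist b o - (dist a b - t)) (dist a o - t) with hle | hle
  · obtain ⟨r, hr0, hr, e⟩ := key a b t h0 h hle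
    exact ⟨a, r, hr0, hr, Subtype.ext e⟩
  · obtain ⟨r, hr0, hr, e⟩ := key b a (dist a b - t) (by linarith)
      (by rw [dist_comm b a]; linarith) (by rw [dist_comm b a]; linarith)
    refine ⟨b, r, hr0, hr, Subtype.ext (Eq.trans ?_ e)⟩
    funext w
    simp only [treePoint, dist_comm b a]
    rw [max_comm, show dist a b - (dist a b - t) = t by ring]

/-- The path between the points descends to where the two segments separate, or to the lower point
if that comes first. The supremum is attained at the far end of the segment carrying the higher
point. -/
theorem dist_mk (o x y : V) (s t : ℝ) (hs0 : 0 ≤ s) (hs : s ≤ dist o x) (ht0 : 0 ≤ t)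
    (ht : t ≤ dist o y) :
    dist (mk o x s hs0 hs) (mk o y t ht0 ht) = s + t - 2 * min (min s t) (gromovProduct o x y) := by
  have : Nonempty V := ⟨o⟩
  have hself : ∀ x : V, gromovProduct o x x = dist o x := fun x => by
    simp [gromovProduct]
  have hcomm : ∀ x y : V, gromovProduct o x y = gromovProduct o y x := fun x y => by
    simp only [gromovProduct, dist_comm x y]; ring
  apply le_antisymm
  · refine ciSup_le fun w => ?_
    change |treePoint o x s w - treePoint o y t w| ≤ _
    rw [treePoint_eq, treePoint_eq, abs_le]
    have h1 := gromovProduct_ultrametric hV o x y w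
    have h2 := gromovProduct_ultrametric hV o y x w
    rw [hcomm y x] at h2
    set p := gromovProduct o x w
    set q := gromovProduct o y w
    set m := gromovProduct o x y
    have a1 : min (min s t) m ≤ t - min t q + min s p := by
      rcases min_choice t q with e | e <;> rcases min_choice s p with e' | e' <;> rw [e, e'] <;>
        rcases min_le_iff.1 h1 with h | h <;> simp only [min_le_iff] <;> grind
    have a2 : min (min s t) m ≤ s - min s p + min t q := by
      rcases min_choice t q with e | e <;> rcases min_choice s p with e' | e' <;> rw [e, e'] <;>
        rcases min_le_iff.1 h2 with h | h <;> simp only [min_le_iff] <;> grind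
    constructor <;> linarith
  · have b1 := le_ciSup (bddAbove_abs_sub (mk o x s hs0 hs) (mk o y t ht0 ht)) y
    have b2 := le_ciSup (bddAbove_abs_sub (mk o x s hs0 hs) (mk o y t ht0 ht)) x
    have b1' : |treePoint o x s y - treePoint o y t y| ≤ dist (mk o x s hs0 hs) (mk o y t ht0 ht) :=
      b1
    have b2' : |treePoint o x s x - treePoint o y t x| ≤ dist (mk o x s hs0 hs) (mk o y t ht0 ht) :=
      b2
    rw [treePoint_eq, treePoint_eq, hself, min_eq_left ht] at b1'
    rw [treePoint_eq, treePoint_eq, hself, min_eq_left hs, hcomm y x] at b2'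
    rcases le_total t s with hst | hst
    · rw [min_eq_right hst]
      have := neg_le_abs (s + dist o x - 2 * s - (t + dist o x - 2 * min t (gromovProduct o x y)))
      linarith
    · rw [min_eq_left hst]
      have := le_abs_self (s + dist o y - 2 * min s (gromovProduct o x y) - (t + dist o y - 2 * t))
      linarith

theorem isGeodesicSpace : IsGeodesicSpace (TreeHull V) := by
  classical
  intro f g
  obtain ⟨o⟩ := f.nonempty_base
  obtain ⟨x, s, hs0, hs, rfl⟩ := exists_eq_mk hV o f
  obtain ⟨y, t, ht0, ht, rfl⟩ := exists_eq_mk hV o g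
  have hself : ∀ x : V, gromovProduct o x x = dist o x := fun x => by simp [gromovProduct]
  have same : ∀ (x : V) (s t : ℝ) (hs0 hs ht0 ht),
      dist (mk o x s hs0 hs) (mk o x t ht0 ht) = |s - t| := by
    intro x s t hs0 hs ht0 ht
    rw [dist_mk hV, hself, min_eq_left ((min_le_left _ _).trans hs)]
    rcases le_total s t with h | h
    · rw [min_eq_left h, abs_of_nonpos (by linarith)]; ring
    · rw [min_eq_right h, abs_of_nonneg (by linarith)]; ring
  set m := min (min s t) (gromovProduct o x y) with hm
  have hD := dist_mk hV o x y s t hs0 hs ht0 ht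
  rw [← hm] at hD
  have hm0 : 0 ≤ m := by
    refine le_min (le_min hs0 ht0) ?_
    have := dist_triangle x o y
    rw [dist_comm x o] at this
    rw [gromovProduct]; linarith
  have hms : m ≤ s := (min_le_left _ _).trans (min_le_left _ _)
  have hmt : m ≤ t := (min_le_left _ _).trans (min_le_right _ _)
  have hmp : m ≤ gromovProduct o x y := min_le_right _ _
  rw [hD]
  -- Descend towards `o` to the height `m`, then ascend towards `y`. The last value is used only
  -- outside the interval.
  let γ : ℝ → TreeHull V := fun r =>
    if h : 0 ≤ r ∧ r ≤ s - m then mk o x (s - r) (by linarith [h.2]) (by linarith [h.1])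
    else if h : s - m ≤ r ∧ r ≤ s + t - 2 * m then
      mk o y (r - s + 2 * m) (by linarith [h.1]) (by linarith [h.2])
    else mk o x s hs0 hs
  have γ1 : ∀ r (h0 : 0 ≤ r) (h : r ≤ s - m),
      γ r = mk o x (s - r) (by linarith) (by linarith) := fun r h0 h => dif_pos ⟨h0, h⟩
  have cross : ∀ r r' (h0 : 0 ≤ r) (h : r ≤ s - m) (h1 : s - m ≤ r') (h2 : r' ≤ s + t - 2 * m),
      dist (mk o x (s - r) (by linarith) (by linarith))
        (mk o y (r' - s + 2 * m) (by linarith) (by linarith)) = r' - r := by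
    intro r r' h0 h h1 h2
    rw [dist_mk hV]
    have : min (min (s - r) (r' - s + 2 * m)) (gromovProduct o x y) = m := by
      apply le_antisymm
      · rw [hm]
        rcases min_choice (min s t) (gromovProduct o x y) with e | e
        · rcases min_choice s t with e' | e'
          · have : m = s := by rw [hm, e, e']
            rw [← hm, min_le_iff, min_le_iff]
            exact Or.inl (Or.inl (by linarith))
          · have : m = t := by rw [hm, e, e']
            rw [← hm, min_le_iff, min_le_iff]
            exact Or.inl (Or.inr (by linarith))
        · rw [e]; exact min_le_right _ _
      · exact le_min (le_min (by linarith) (by linarith)) hmp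
    rw [this]; ring
  have γ2 : ∀ r (h1 : s - m ≤ r) (h2 : r ≤ s + t - 2 * m),
      γ r = mk o y (r - s + 2 * m) (by linarith) (by linarith) := by
    intro r h1 h2
    by_cases h : 0 ≤ r ∧ r ≤ s - m
    · rw [γ1 r h.1 h.2]
      apply eq_of_dist_eq_zero
      rw [cross r r h.1 h.2 h1 h2, sub_self]
    · exact (dif_neg h).trans (dif_pos ⟨h1, h2⟩)
  refine ⟨γ, ?_, ?_, ?_⟩
  · rw [γ1 0 le_rfl (by linarith)]; simp
  · rw [γ2 _ (by linarith) le_rfl]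
    simp only [show s + t - 2 * m - s + 2 * m = t by ring]
  · intro r hr r' hr'
    rcases le_total r (s - m) with h | h <;> rcases le_total r' (s - m) with h' | h'
    · rw [γ1 r hr.1 h, γ1 r' hr'.1 h', same, ← abs_neg]; congr 1; ring
    · rw [γ1 r hr.1 h, γ2 r' h' hr'.2, cross r r' hr.1 h h' hr'.2, abs_of_nonpos (by linarith)]
      ring
    · rw [γ1 r' hr'.1 h', γ2 r h hr.2, dist_comm, cross r' r hr'.1 h' h hr.2,
        abs_of_nonneg (by linarith)]
    · rw [γ2 r h hr.2, γ2 r' h' hr'.2, same]; congr 1; ring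

/-- If `V` is a discrete geodesic space, then it is coarsely dense in the tree it spans. -/
theorem exists_dist_ofPoint_le (o : V)
    (hd : ∀ x t, 0 ≤ t → t ≤ dist o x → ∃ v, dist o v + dist v x = dist o x ∧ |t - dist o v| ≤ 1)
    (f : TreeHull V) : ∃ v, dist f (ofPoint v) ≤ 1 := by
  obtain ⟨x, t, h0, h, rfl⟩ := exists_eq_mk hV o f
  obtain ⟨v, hv, hv'⟩ := hd x t h0 h
  refine ⟨v, ?_⟩
  have e : ofPoint v = mk o v (dist o v) dist_nonneg le_rfl := by
    refine Subtype.ext (funext fun w => ?_)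
    rw [ofPoint_val]
    have := dist_triangle o v w
    simp only [mk, treePoint, sub_self, sub_zero]
    rw [max_eq_right (by linarith)]
  have e' : gromovProduct o x v = dist o v := by
    rw [gromovProduct, dist_comm x v]; linarith
  rw [e, dist_mk hV, e', min_eq_left (min_le_right _ _)]
  refine le_trans (le_of_eq ?_) hv'
  rcases le_total t (dist o v) with h | h
  · rw [min_eq_left h, abs_of_nonpos (by linarith)]; ring
  · rw [min_eq_right h, abs_of_nonneg (by linarith)]; ring

end ZeroHyperbolic

/-- Replacing points by nearby points of `V` changes distances by at most 2, hence Gromov products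
by at most 3. Two products are compared, whence 6. -/
theorem isGromovHyperbolic
    (hV : ∀ x y z w : V, dist x z + dist y w ≤ max (dist x y + dist z w) (dist x w + dist y z))
    (hd : ∀ f : TreeHull V, ∃ v, dist f (ofPoint v) ≤ 1) : IsGromovHyperbolic (TreeHull V) := by
  refine ⟨6, by norm_num, fun w x y z => ?_⟩
  obtain ⟨w', hw⟩ := hd w
  obtain ⟨x', hx⟩ := hd x
  obtain ⟨y', hy⟩ := hd y
  obtain ⟨z', hz⟩ := hd z
  have close : ∀ {p q : TreeHull V} {p' q' : V}, dist p (ofPoint p') ≤ 1 →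
      dist q (ofPoint q') ≤ 1 → dist p q ≤ dist p' q' + 2 ∧ dist p' q' ≤ dist p q + 2 := by
    intro p q p' q' hp hq
    rw [← dist_ofPoint p' q']
    have h1 := dist_triangle4 p (ofPoint p') (ofPoint q') q
    have h2 := dist_triangle4 (ofPoint p') p q (ofPoint q')
    rw [dist_comm (ofPoint q') q] at h1
    rw [dist_comm (ofPoint p') p] at h2
    constructor <;> linarith
  have hwx := close hw hx
  have hwy := close hw hy
  have hwz := close hw hz
  have hxy := close hx hy
  have hyz := close hy hz
  have hxz := close hx hz
  have h := gromovProduct_ultrametric hV w' x' y' z'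
  simp only [gromovProduct] at *
  rcases min_le_iff.1 h with h | h
  · refine (sub_le_sub_right (min_le_left _ _) _).trans ?_
    linarith [hwx.1, hwx.2, hwy.1, hwy.2, hwz.1, hwz.2, hxy.1, hxy.2, hxz.1, hxz.2]
  · refine (sub_le_sub_right (min_le_right _ _) _).trans ?_
    linarith [hwx.1, hwx.2, hwy.1, hwy.2, hwz.1, hwz.2, hyz.1, hyz.2, hxz.1, hxz.2]

/-- An action on the spanned tree is acylindrical if it is uniformly proper on `V`. -/
theorem isAcylindricalAction {G : Type*} [Group G] [MulAction G V] [IsIsometricSMul G V]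
    (hd : ∀ f : TreeHull V, ∃ v, dist f (ofPoint v) ≤ 1)
    (hp : ∀ ε : ℝ, ∃ N : ℕ, ∀ v : V, {g : G | dist v (g • v) ≤ ε}.encard ≤ N) :
    IsAcylindricalAction G (TreeHull V) := by
  intro ε _
  -- Passing from `f` to `v` costs 1 at each end of the displacement.
  obtain ⟨N, hN⟩ := hp (ε + 2)
  refine ⟨N + 1, 1, Nat.succ_pos N, one_pos, fun f _ _ => ?_⟩
  obtain ⟨v, hv⟩ := hd f
  refine (Set.encard_le_encard ?_).trans ((hN v).trans (by exact_mod_cast N.le_succ))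
  rintro g ⟨hg, -⟩
  change dist v (g • v) ≤ ε + 2
  rw [← dist_ofPoint, ← smul_ofPoint]
  have h1 := dist_triangle4 (ofPoint v) f (g • f) (g • ofPoint v)
  rw [dist_smul, dist_comm (ofPoint v) f] at h1
  linarith

end TreeHull

end TreeHull

/-! ### Free groups are acylindrically hyperbolic -/

section FreeGroupMetric

variable {α : Type*} [DecidableEq α]

/-- The length of the longest common prefix of two lists. -/
def commonPrefixLength {β : Type*} [DecidableEq β] : List β → List β → ℕ
  | a :: l, b :: l' => if a = b then commonPrefixLength l l' + 1 else 0
  | _, _ => 0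

theorem commonPrefixLength_ultrametric {β : Type*} [DecidableEq β] :
    ∀ l₁ l₂ l₃ : List β, min (commonPrefixLength l₁ l₂) (commonPrefixLength l₂ l₃) ≤
      commonPrefixLength l₁ l₃
  | [], _, _ => by simp [commonPrefixLength]
  | _ :: _, [], _ => by simp [commonPrefixLength]
  | _ :: _, _ :: _, [] => by simp [commonPrefixLength]
  | a :: l₁, b :: l₂, c :: l₃ => by
    have ih := commonPrefixLength_ultrametric l₁ l₂ l₃
    simp only [commonPrefixLength]
    by_cases h : a = b
    · by_cases h' : b = c
      · subst h h'
        simp only [if_true]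
        omega
      · simp [h']
    · simp [h]

namespace FreeGroup

theorem IsReduced.norm_mk {L : List (α × Bool)} (h : IsReduced L) : norm (mk L) = L.length := by
  rw [norm, toWord_mk, h.reduce_eq]

theorem IsReduced.invRev {L : List (α × Bool)} (h : IsReduced L) : IsReduced (invRev L) := by
  rw [isReduced_iff_reduce_eq, reduce_invRev, h.reduce_eq]

/-- Cancellation removes the common prefix from both words and then stops, since distinct first
letters leave a reduced concatenation. -/
theorem norm_inv_mk_mul_mk : ∀ {L₁ L₂ : List (α × Bool)}, IsReduced L₁ → IsReduced L₂ →
    norm ((mk L₁)⁻¹ * mk L₂) + 2 * commonPrefixLength L₁ L₂ = L₁.length + L₂.length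
  | [], L₂, _, h₂ => by
    simp only [commonPrefixLength, inv_mk, invRev_empty, mul_mk, List.nil_append, h₂.norm_mk]
    simp
  | a :: L₁, [], h₁, _ => by
    simp only [commonPrefixLength, mul_mk, inv_mk, List.append_nil, h₁.invRev.norm_mk,
      invRev_length]
    simp
  | a :: L₁, b :: L₂, h₁, h₂ => by
    by_cases hab : a = b
    · subst hab
      have ih := norm_inv_mk_mul_mk (h₁.infix (List.suffix_cons a L₁).isInfix)
        (h₂.infix (List.suffix_cons a L₂).isInfix)
      have e : (mk (a :: L₁))⁻¹ * mk (a :: L₂) = (mk L₁)⁻¹ * mk L₂ := by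
        rw [show a :: L₁ = [a] ++ L₁ from rfl, show a :: L₂ = [a] ++ L₂ from rfl, ← mul_mk,
          ← mul_mk]
        group
      rw [e]
      simp only [commonPrefixLength, if_true, List.length_cons]
      omega
    · have hred : IsReduced (FreeGroup.invRev (a :: L₁) ++ b :: L₂) := by
        refine List.isChain_append.2 ⟨h₁.invRev, h₂, ?_⟩
        intro x hx y hy
        rw [invRev_cons] at hx
        simp only [FreeGroup.invRev, List.map_cons, List.map_nil, List.reverse_cons,
          List.reverse_nil, List.nil_append, List.getLast?_append, List.getLast?_singleton,
          Option.some_or, Option.mem_def, Option.some.injEq, List.head?_cons] at hx hy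
        subst hx hy
        intro h
        by_contra h'
        refine hab (Prod.ext h ?_)
        revert h'
        cases a.2 <;> cases b.2 <;> simp
      rw [inv_mk, mul_mk, hred.norm_mk]
      simp [commonPrefixLength, hab]

theorem norm_inv_mul (x y : FreeGroup α) :
    norm (x⁻¹ * y) + 2 * commonPrefixLength x.toWord y.toWord = norm x + norm y := by
  have := norm_inv_mk_mul_mk (isReduced_toWord (x := x)) (isReduced_toWord (x := y))
  rwa [mk_toWord, mk_toWord] at this

/-- The word metric on a free group. -/
noncomputable instance wordMetricSpace : MetricSpace (FreeGroup α) where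
  dist x y := norm (x⁻¹ * y)
  dist_self x := by simp
  dist_comm x y := by rw [← norm_inv_eq]; simp
  dist_triangle x y z := by
    have := norm_mul_le (x⁻¹ * y) (y⁻¹ * z)
    rw [mul_assoc, mul_inv_cancel_left] at this
    exact_mod_cast this
  eq_of_dist_eq_zero {x y} h := by
    have h' : norm (x⁻¹ * y) = 0 := by exact_mod_cast h
    exact (inv_mul_eq_one.1 (norm_eq_zero.1 h'))

theorem dist_eq_norm_inv_mul (x y : FreeGroup α) : dist x y = norm (x⁻¹ * y) := rfl

instance : IsIsometricSMul (FreeGroup α) (FreeGroup α) where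
  isometry_smul g := Isometry.of_dist_eq fun x y => by
    simp only [dist_eq_norm_inv_mul, smul_eq_mul]
    congr 2
    group

/-- After translating `w` to `1`, this is the ultrametric inequality for common prefixes. -/
theorem four_point (x y z w : FreeGroup α) :
    dist x z + dist y w ≤ max (dist x y + dist z w) (dist x w + dist y z) := by
  rw [← dist_smul w⁻¹ x z, ← dist_smul w⁻¹ y w, ← dist_smul w⁻¹ x y, ← dist_smul w⁻¹ z w,
    ← dist_smul w⁻¹ x w, ← dist_smul w⁻¹ y z]
  simp only [smul_eq_mul, inv_mul_cancel]
  generalize w⁻¹ * x = x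
  generalize w⁻¹ * y = y
  generalize w⁻¹ * z = z
  have h := commonPrefixLength_ultrametric x.toWord y.toWord z.toWord
  have hxy := norm_inv_mul x y
  have hyz := norm_inv_mul y z
  have hxz := norm_inv_mul x z
  simp only [dist_eq_norm_inv_mul, mul_one, norm_inv_eq]
  norm_cast
  omega

theorem exists_prefix (x : FreeGroup α) (t : ℝ) (h0 : 0 ≤ t) (h : t ≤ dist 1 x) :
    ∃ v : FreeGroup α, dist 1 v + dist v x = dist 1 x ∧ |t - dist 1 v| ≤ 1 := by
  have hx : dist 1 x = x.toWord.length := by simp [dist_eq_norm_inv_mul, norm]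
  rw [hx] at h
  have hk : ⌊t⌋₊ ≤ x.toWord.length := Nat.floor_le_of_le h
  set k := ⌊t⌋₊
  have h1 : norm (mk (x.toWord.take k)) = k := by
    rw [((isReduced_toWord (x := x)).infix (List.take_prefix _ _).isInfix).norm_mk,
      List.length_take, min_eq_left hk]
  have h2 : norm ((mk (x.toWord.take k))⁻¹ * x) = x.toWord.length - k := by
    have e : (mk (x.toWord.take k))⁻¹ * x = mk (x.toWord.drop k) := by
      rw [inv_mul_eq_iff_eq_mul, mul_mk, List.take_append_drop, mk_toWord]
    rw [e, ((isReduced_toWord (x := x)).infix (List.drop_suffix _ _).isInfix).norm_mk,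
      List.length_drop]
  refine ⟨mk (x.toWord.take k), ?_, ?_⟩
  · rw [hx, dist_eq_norm_inv_mul, dist_eq_norm_inv_mul, h2, inv_one, one_mul, h1]
    push_cast [hk]
    ring
  · rw [dist_eq_norm_inv_mul, inv_one, one_mul, h1]
    have := Nat.floor_le h0
    have := Nat.lt_floor_add_one t
    rw [abs_le]
    constructor <;> linarith

theorem exists_encard_le [Finite α] (ε : ℝ) :
    ∃ N : ℕ, ∀ v : FreeGroup α, {g : FreeGroup α | dist v (g • v) ≤ ε}.encard ≤ N := by
  have hfin : {g : FreeGroup α | norm g ≤ ⌊ε⌋₊}.Finite :=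
    Set.Finite.of_finite_image ((List.finite_length_le (α × Bool) ⌊ε⌋₊).subset (by
      rintro _ ⟨g, hg, rfl⟩; exact hg)) (toWord_injective.injOn)
  refine ⟨{g : FreeGroup α | norm g ≤ ⌊ε⌋₊}.ncard, fun v => ?_⟩
  rw [hfin.cast_ncard_eq]
  -- Conjugation by `v` carries the set into a ball around `1`, so the bound is uniform in `v`.
  refine Set.encard_le_encard_of_injOn (f := fun g => v⁻¹ * (g * v)) ?_ ?_
  · intro g hg
    exact Nat.le_floor hg
  · intro g _ g' _ h
    simpa using h

theorem dist_one_of_zpow (a : α) (n : ℤ) : dist 1 (of a ^ n) = |(n : ℝ)| := by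
  rw [dist_eq_norm_inv_mul, inv_one, one_mul]
  obtain ⟨n, rfl | rfl⟩ := n.eq_nat_or_neg
  · simp
  · rw [zpow_neg, norm_inv_eq]
    simp

theorem dist_of_zpow_of_zpow {a b : α} (hab : a ≠ b) (m n : ℤ) :
    dist (of a ^ m) (of b ^ n) = |(m : ℝ)| + |(n : ℝ)| := by
  have hword : ∀ (a : α) (m : ℤ), ∀ p ∈ (of a ^ m).toWord, p.1 = a := by
    intro a m p hp
    obtain ⟨n, rfl | rfl⟩ := m.eq_nat_or_neg
    · rw [zpow_natCast, toWord_of_pow] at hp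
      rw [List.eq_of_mem_replicate hp]
    · rw [zpow_neg, zpow_natCast, toWord_inv, toWord_of_pow] at hp
      simp only [invRev, List.map_replicate, List.reverse_replicate] at hp
      rw [List.eq_of_mem_replicate hp]
  have hzero : commonPrefixLength (of a ^ m).toWord (of b ^ n).toWord = 0 := by
    have h1 := hword a m
    have h2 := hword b n
    generalize (of a ^ m).toWord = w at h1
    generalize (of b ^ n).toWord = w' at h2
    rcases w with _ | ⟨p, l⟩
    · rfl
    rcases w' with _ | ⟨q, l'⟩
    · rfl
    refine if_neg fun h => hab ?_
    rw [← h1 p (by simp), ← h2 q (by simp), h]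
  have h := norm_inv_mul (of a ^ m) (of b ^ n)
  rw [hzero, mul_zero, add_zero] at h
  rw [← dist_one_of_zpow a m, ← dist_one_of_zpow b n, dist_eq_norm_inv_mul, h]
  simp [dist_eq_norm_inv_mul]

open TreeHull in
theorem acylindricallyHyperbolic.{u₁, u₂} (α : Type u₁) [Finite α] [Nontrivial α] :
    AcylindricallyHyperbolic.{u₁, max u₁ u₂} (FreeGroup α) := by
  classical
  -- The lift places the space in the required universe.
  let V := ULift.{u₂} (FreeGroup α)
  have hV : ∀ x y z w : V,
      dist x z + dist y w ≤ max (dist x y + dist z w) (dist x w + dist y z) :=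
    fun x y z w => four_point x.down y.down z.down w.down
  have hd : ∀ f : TreeHull V, ∃ v, dist f (ofPoint v) ≤ 1 :=
    exists_dist_ofPoint_le hV ⟨1⟩ fun x t h0 h => by
      obtain ⟨v, h1, h2⟩ := exists_prefix x.down t h0 h
      exact ⟨⟨v⟩, h1, h2⟩
  have hp : ∀ ε : ℝ, ∃ N : ℕ, ∀ v : V, {g : FreeGroup α | dist v (g • v) ≤ ε}.encard ≤ N :=
    fun ε => (exists_encard_le ε).imp fun N hN v => hN v.down
  have hX := isGromovHyperbolic hV hd
  let o : TreeHull V := ofPoint ⟨1⟩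
  have hdist : ∀ g h : FreeGroup α, dist (g • o) (h • o) = dist g h := by
    intro g h
    rw [smul_ofPoint, smul_ofPoint, dist_ofPoint]
    change dist (g • (1 : FreeGroup α)) (h • (1 : FreeGroup α)) = _
    simp
  have hlox : ∀ a : α, IsLoxodromic (TreeHull V) (of a) := by
    intro a
    refine ⟨o, 1, 0, le_rfl, le_rfl, fun m n => ?_⟩
    have : dist (of a ^ m • o) (of a ^ n • o) = |(m : ℝ) - n| := by
      rw [hdist, ← dist_smul ((of a ^ m)⁻¹), smul_eq_mul, smul_eq_mul, inv_mul_cancel,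
        ← zpow_neg, ← zpow_add, dist_one_of_zpow, ← abs_neg]
      push_cast
      congr 1
      ring
    rw [this]
    constructor <;> simp
  obtain ⟨a, b, hab⟩ := exists_pair_ne α
  refine ⟨TreeHull V, inferInstance, inferInstance, hX, isGeodesicSpace hV, inferInstance,
    isAcylindricalAction hd hp, of a, of b, hlox a, hlox b, ?_⟩
  rw [Set.disjoint_left]
  rintro _ ⟨x, k, hk, rfl⟩ ⟨y, l, hl, e⟩
  have ht := (Quotient.exact e : ∀ w : TreeHull V, Tendsto
    (fun n : ℕ => gromovProduct w (of a ^ k n • x) (of b ^ l n • y)) atTop atTop) o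
  -- At `o`, powers of `of a` and `of b` applied to `o` have Gromov product 0. Replacing `o` by `x`
  -- and `y` in the orbits raises it by at most `dist o x + dist o y`, so it cannot diverge.
  obtain ⟨n, hn⟩ := (ht.eventually_gt_atTop (dist o x + dist o y)).exists
  have key := dist_of_zpow_of_zpow hab (k n) (l n)
  rw [← dist_one_of_zpow a, ← dist_one_of_zpow b, ← hdist, ← hdist, ← hdist, one_smul] at key
  have h1 := dist_triangle o (of a ^ k n • o) (of a ^ k n • x)
  have h2 := dist_triangle o (of b ^ l n • o) (of b ^ l n • y)
  have h3 := dist_triangle4 (of a ^ k n • o) (of a ^ k n • x) (of b ^ l n • y) (of b ^ l n • o)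
  rw [dist_comm (of b ^ l n • y)] at h3
  rw [dist_smul] at h1 h2 h3
  rw [dist_smul] at h3
  rw [gromovProduct] at hn
  linarith

end FreeGroup

end FreeGroupMetric

/-! ### Assembly of the three claims -/

theorem mainTheorem6 :
    AcylindricallyHyperbolic.{0, v} (FreeGroup (Fin 2)) ∧
    (∀ (I : Type u) (U : Ultrafilter I), (∀ i : I, U ≠ pure i) →
      (Countable I ∨ ¬ CountableInterFilter (U : Filter I)) →
      (FreeGroup (Fin 2) ≅[groupLanguage] Germ (U : Filter I) (FreeGroup (Fin 2))) ∧
      (∀ g : Germ (U : Filter I) (FreeGroup (Fin 2)),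
        Uncountable (Subgroup.centralizer {g})) ∧
      ¬ AcylindricallyHyperbolic.{u, v} (Germ (U : Filter I) (FreeGroup (Fin 2)))) ∧
    (∃ (G : Type) (_ : Group G),
      Nonempty (FreeGroup (Fin 2) ↪ₑ[groupLanguage] G) ∧
      Countable G ∧
      (∀ g : G, g ≠ 1 → ¬ IsOfFinOrder g) ∧
      ¬ Group.FG G ∧
      (∀ g : G, ¬ IsCyclic (Subgroup.centralizer {g})) ∧
      ¬ AcylindricallyHyperbolic.{0, v} G) := by
  refine ⟨FreeGroup.acylindricallyHyperbolic.{0, v} (Fin 2), fun I U hU hI => ?_, ?_⟩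
  · have hU' : ¬ CountableInterFilter (U : Filter I) := by
      rcases hI with hI | hI
      · exact not_countableInterFilter_of_countable hU
      · exact hI
    obtain ⟨φ, hφ⟩ := exists_tendsto_atTop_of_not_countableInter hU'
    exact ⟨(diagonalElementaryEmbedding U _).elementarilyEquivalent,
      uncountable_centralizer_germ hφ,
      not_acylindricallyHyperbolic_of_commute (exists_commute_pow_ne_zpow hφ)⟩
  · have : Countable (FreeGroup (Fin 2)) := FreeGroup.toWord_injective.countable
    refine exists_elementary_extension.{v} _ ⟨FreeGroup.of 0, FreeGroup.of 1, fun h => ?_⟩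
    exact absurd (congrArg FreeGroup.toWord h) (by decide)
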